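/- Let $X$ be a proper metric space with base point $o$, with isometry group $\mathrm{Isom}(X)$, and write $(x|y)=\frac12\big(d(x,o)+d(y,o)-d(x,y)\big)$. Assume that $X$ is Gromov-hyperbolic: there is $\delta\ge 0$ with $(x|z)\ge\min\{(x|y),(y|z)\}-\delta$ for all $x,y,z\in X$. Definitions. For $P\subseteq X$, the critical exponent is $\delta_P=\limsup_{n\to\infty}\frac1n\log\#\{x\in P : d(o,x)\le n\}\in[-\infty,\infty]$. A set $P\subseteq X$ is separated if there is $\varepsilon>0$ with $d(x,y)>\varepsilon$ for all distinct $x,y\in P$. It covers $Y\subseteq X$ if there is $\varepsilon>0$ such that every point of $Y$ is at distance at most $\varepsilon$ from a point of $P$. The entropy is $h_P=\sup_S\delta_{P\cap S}$, over all separated $S\subseteq X$, with $h_\emptyset=0$. For $A\subseteq\mathrm{Isom}(X)$ put $\delta_A=\delta_{Ao}$ and $h_A=h_{Ao}$, where $Ao=\{\gamma o:\gamma\in A\}$. The set $A$ is separated if $Ao$ is separated and $\gamma\mapsto\gamma o$ is injective on $A$, and $A$ covers $B\subseteq\mathrm{Isom}(X)$ if $Ao$ covers $Bo$. The limit set $\Lambda_\Gamma$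 of a semigroup $\Gamma\subseteq\mathrm{Isom}(X)$ is the set of sequences $(x_i)$ in $\Gamma o$ with $\lim_{i,j\to\infty}(x_i|x_j)=\infty$, modulo the equivalence relation $(x_i)\sim(y_j)\iff\lim_{i,j\to\infty}(x_i|y_j)=\infty$. Theorem. Let $\Gamma$ be a subsemigroup of $\mathrm{Isom}(X)$ whose limit set $\Lambda_\Gamma$ contains at least two points. Then for every separated subset $S\subseteq\Gamma$ that covers $\Gamma$, $$\lim_{n\to\infty}\frac1n\log\#\{\gamma\in S : d(o,\gamma o)\le n\}=h_\Gamma$$ (a limit in $[-\infty,\infty]$). In particular, if $\Gamma$ itself is separated, then its critical exponent is a true limit: $$\delta_\Gamma=\lim_{n\to\infty}\frac1n\log\#\{\gamma\in \Gamma : d(o,\gamma o)\le n\}.$$ -/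

import Mathlib

open Set Filter Topology
open scoped ENNReal NNReal

noncomputable section

namespace HypIsom

variable {X : Type*} [MetricSpace X]

/-- The Gromov product `(x|y)` with respect to the base point `o`. -/
def gromovProduct (o x y : X) : ℝ := (dist x o + dist y o - dist x y) / 2

/-- Gromov hyperbolicity of `X`, seen from the base point `o` (changing the base point at most
doubles the constant `δ`, so that the property does not depend on `o`). -/
def IsGromovHyperbolic (o : X) : Prop :=
  ∃ δ : ℝ, 0 ≤ δ ∧ ∀ x y z : X,
    min (gromovProduct o x y) (gromovProduct o y z) - δ ≤ gromovProduct o x z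

/-- Sequences in `A` that converge at infinity: `(x i | x j) → ∞` as `i, j → ∞`. -/
def ConvergentSeq (o : X) (A : Set X) : Type _ :=
  {x : ℕ → X // (∀ i, x i ∈ A) ∧
    Tendsto (fun p : ℕ × ℕ => gromovProduct o (x p.1) (x p.2)) atTop atTop}

/-- Two convergent sequences are equivalent if `(x i | y j) → ∞` as `i, j → ∞`. -/
def boundaryRel (o : X) (A : Set X) (x y : ConvergentSeq o A) : Prop :=
  Tendsto (fun p : ℕ × ℕ => gromovProduct o (x.1 p.1) (y.1 p.2)) atTop atTop

/-- The relation is an equivalence relation in a Gromov-hyperbolic space, so that the quotient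
below identifies exactly the equivalent sequences. -/
theorem boundaryRel_equivalence (o : X) (A : Set X) (hX : IsGromovHyperbolic o) :
    Equivalence (boundaryRel o A) := by
  refine ⟨fun x => x.2.2, ?_, ?_⟩
  · intro x y h
    have h2 : Tendsto (fun p : ℕ × ℕ => gromovProduct o (x.1 p.2) (y.1 p.1)) atTop atTop := by
      have hs : Tendsto (Prod.swap : ℕ × ℕ → ℕ × ℕ) atTop atTop := by
        rw [← prod_atTop_atTop_eq]
        exact tendsto_snd.prodMk tendsto_fst
      exact h.comp hs
    refine h2.congr fun p => ?_
    simp only [gromovProduct, dist_comm (x.1 p.2) (y.1 p.1)]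
    ring
  · intro x y z hxy hyz
    obtain ⟨δ, -, hδ⟩ := hX
    rw [boundaryRel, tendsto_atTop] at *
    intro b
    obtain ⟨p, hp⟩ := eventually_atTop.1 (hxy (b + δ))
    obtain ⟨q, hq⟩ := eventually_atTop.1 (hyz (b + δ))
    refine eventually_atTop.2 ⟨(p.1, q.2), fun r hr => ?_⟩
    have h1 := hp (r.1, p.2 ⊔ q.1) ⟨hr.1, le_sup_left⟩
    have h2 := hq (p.2 ⊔ q.1, r.2) ⟨le_sup_right, hr.2⟩
    have h3 := hδ (x.1 r.1) (y.1 (p.2 ⊔ q.1)) (z.1 r.2)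
    have h4 := le_min h1 h2
    linarith

/-- The Gromov boundary `∂A` of a subset `A` of `X`. -/
def Boundary (o : X) (A : Set X) : Type _ := Quot (boundaryRel o A)

/-- The orbit `A o` of the base point under a set `A` of isometries. -/
def orbit (o : X) (A : Set (X ≃ᵢ X)) : Set X := (fun γ : X ≃ᵢ X => γ o) '' A

/-- The limit set of a semigroup of isometries: the Gromov boundary of the orbit of `o`. -/
def LimitSet (o : X) (Γ : Subsemigroup (X ≃ᵢ X)) : Type _ := Boundary o (orbit o (Γ : Set (X ≃ᵢ X)))

/-- A separated subset of a metric space: `d(x, y) > ε` for distinct points, for some `ε > 0`. -/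
def Separated (P : Set X) : Prop := ∃ ε : ℝ, 0 < ε ∧ P.Pairwise fun x y => ε < dist x y

/-- `P` covers `Y`: every point of `Y` is within `ε` of a point of `P`, for some `ε > 0`. -/
def Covering (P Y : Set X) : Prop := ∃ ε : ℝ, 0 < ε ∧ ∀ y ∈ Y, ∃ x ∈ P, dist x y ≤ ε

/-- The exponential growth quotient `(1/n) log N`, in `[-∞, ∞]`, of a possibly infinite
cardinality `N` (with `log 0 = -∞` and `log ∞ = ∞`). -/
def logRate (N : ℕ∞) (n : ℕ) : EReal := ENNReal.log (N : ℝ≥0∞) / (n : EReal)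

/-- The critical exponent of a subset of `X`. -/
def criticalExponent (o : X) (P : Set X) : EReal :=
  limsup (fun n : ℕ => logRate (Metric.closedBall o (n : ℝ) ∩ P).encard n) atTop

open Classical in
/-- The entropy of a subset of `X`: the supremum of the critical exponents of its intersections
with the separated subsets of `X`, and `0` for the empty set. -/
def entropy (o : X) (P : Set X) : EReal :=
  if P = ∅ then 0 else ⨆ S : {S : Set X // Separated S}, criticalExponent o (P ∩ S.1)

/-- A set of isometries is separated if its orbit is and distinct elements move `o` to distinct
points. -/
def SeparatedIsom (o : X) (A : Set (X ≃ᵢ X)) : Prop :=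
  Separated (orbit o A) ∧ InjOn (fun γ : X ≃ᵢ X => γ o) A

/-- A set `A` of isometries covers a set `B` of isometries if the orbit of `A` covers that
of `B`. -/
def CoveringIsom (o : X) (A B : Set (X ≃ᵢ X)) : Prop := Covering (orbit o A) (orbit o B)

/-- The critical exponent of a set of isometries: that of the orbit of `o`. -/
def criticalExponentIsom (o : X) (A : Set (X ≃ᵢ X)) : EReal := criticalExponent o (orbit o A)

/-- The entropy of a set of isometries: that of the orbit of `o`. -/
def entropyIsom (o : X) (A : Set (X ≃ᵢ X)) : EReal := entropy o (orbit o A)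

end HypIsom

end

/-! Write |g| = d(o, g o) and let N(n) count the γ in S with |γ| ≤ n. Everything rests on N(n) N(m)
≤ K (n+1)² N(n+m+c), proved in `exists_mul_le`. The polynomial factor involves n only, so for fixed
n the inequality can be iterated in m: the lower growth rate is at least log(N(n) / (K (n+1)²)) /
(n+c). Taking n large with N(n) close to the upper rate yields limsup ≤ liminf
(`limsup_logRate_le_liminf`).

Suppose first that s o and u s o diverge early compared with |s|, for some s, u in Γ. Given γ', γ in
S, apply s to γ' o until the result no longer points towards s⁻¹ o
(`exists_pow_gromovProduct_inv_le`). Inserting s or u s between γ and s^k γ' then avoids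
cancellation (`gromovProduct_le_or_le`). A nearby element of S, together with k, the choice of
connector and the integer part of |s^k γ'|, determines (γ', γ) up to bounded ambiguity
(`dist_le_of_aligned`).

If there are no such s and u, every u in Γ almost fixes the directions of all sufficiently distant
orbit points. Two distinct limit points then confine u o to a neighbourhood of a line, so N grows at
most linearly and the inequality follows from monotonicity.

The common rate is the entropy because nearest-point maps into S o have bounded fibres on separated
sets (`entropyIsom_eq_limsup`). -/

namespace HypIsom

/-! ### Counting with bounded fibres. -/

section Counting

/-- A map with fibres of at most `k` elements shrinks cardinalities by a factor of at most `k`. -/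
theorem ncard_le_mul_of_fiber_le {α β : Type*} {A : Set α} {B : Set β} (hA : A.Finite)
    (hB : B.Finite) (f : α → β) (hf : MapsTo f A B) (k : ℕ)
    (h : ∀ b ∈ B, {a ∈ A | f a = b}.ncard ≤ k) : A.ncard ≤ k * B.ncard := by
  classical
  rw [ncard_eq_toFinset_card A hA, ncard_eq_toFinset_card B hB]
  refine Finset.card_le_mul_card_image_of_maps_to (f := f) ?_ k ?_
  · intro a ha
    simp only [Finite.mem_toFinset] at ha ⊢
    exact hf ha
  · intro b hb
    refine le_trans (le_of_eq ?_) (h b (by simpa using hb))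
    rw [← ncard_coe_finset]
    congr 1
    ext a
    simp

/-- An `ε`-separated family of points in a ball around a translate of `o` has a number of
elements that is bounded in terms of the radius. -/
theorem exists_encard_le_of_separated {X : Type*} [MetricSpace X] [ProperSpace X] {ι : Type*}
    (o : X) {ε : ℝ} (hε : 0 < ε) (r : ℝ) :
    ∃ K : ℕ, ∀ (f : ι → X) (A : Set ι), (A.Pairwise fun i j => ε < dist (f i) (f j)) →
      ∀ g : X ≃ᵢ X, (∀ i ∈ A, dist (g o) (f i) ≤ r) → A.encard ≤ K := by
  -- Pulling back by g reduces to one fixed ball around o, so the bound is uniform in g; each ball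
  -- of radius ε / 2 holds at most one point of the family.
  obtain ⟨t, ht, hcov⟩ := Metric.totallyBounded_iff.1
    (isCompact_closedBall o r).totallyBounded (ε / 2) (half_pos hε)
  refine ⟨t.ncard, fun f A hA g hg => ?_⟩
  have hmem : ∀ i, ∃ y, i ∈ A → y ∈ t ∧ dist (g.symm (f i)) y < ε / 2 := by
    intro i
    by_cases hi : i ∈ A
    swap
    · exact ⟨o, fun h => absurd h hi⟩
    have h1 : g.symm (f i) ∈ Metric.closedBall o r := by
      rw [Metric.mem_closedBall, dist_comm, ← g.isometry.dist_eq, g.apply_symm_apply]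
      exact hg i hi
    obtain ⟨y, hy⟩ : ∃ y ∈ t, dist (g.symm (f i)) y < ε / 2 := by simpa using hcov h1
    exact ⟨y, fun _ => hy⟩
  choose c hc' using hmem
  have hct := fun i hi => (hc' i hi).1
  have hc := fun i hi => (hc' i hi).2
  rw [ht.cast_ncard_eq]
  refine encard_le_encard_of_injOn (f := c) hct ?_
  intro i hi j hj hij
  by_contra hne
  have h1 := hA hi hj hne
  have h2 := hc i hi
  have h3 := hc j hj
  rw [← hij] at h3
  have h4 := dist_triangle_right (g.symm (f i)) (g.symm (f j)) (c i)
  rw [g.symm.isometry.dist_eq] at h4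
  linarith

end Counting

/-! ### Growth rates of almost supermultiplicative sequences. -/

section Growth

theorem logRate_natCast {N n : ℕ} (hN : 1 ≤ N) :
    logRate (N : ℕ∞) n = ((Real.log N / n : ℝ) : EReal) := by
  have h : ENNReal.log (((N : ℕ∞) : ℝ≥0∞)) = ((Real.log N : ℝ) : EReal) := by
    rw [ENNReal.log_pos_real (by simp; omega) (by simp)]
    simp
  rw [logRate, h, EReal.coe_div]
  simp

theorem logRate_mono {M N : ℕ∞} (h : M ≤ N) (n : ℕ) : logRate M n ≤ logRate N n := by
  unfold logRate
  exact EReal.div_le_div_right_of_nonneg (by positivity)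
    (ENNReal.log_monotone (by exact_mod_cast h))

variable {N : ℕ → ℕ}

theorem pow_le_of_mul_le (hmono : Monotone N) {n m₀ q : ℕ} {θ : ℝ} (hθ : 0 ≤ θ)
    (h₀ : 1 ≤ N m₀) (hstep : ∀ m, θ * N m ≤ N (m + q)) (k : ℕ) (hn : m₀ + k * q ≤ n) :
    θ ^ k ≤ N n := by
  have key : θ ^ k ≤ N (m₀ + k * q) := by
    clear hn
    induction k with
    | zero => simpa using h₀
    | succ k ih =>
      calc θ ^ (k + 1) = θ * θ ^ k := by ring
        _ ≤ θ * N (m₀ + k * q) := by gcongr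
        _ ≤ N (m₀ + k * q + q) := hstep _
        _ = N (m₀ + (k + 1) * q) := by congr 2; ring
  exact key.trans (by exact_mod_cast hmono hn)

/-- A supermultiplicativity step bounds the growth rate from below. -/
theorem eventually_mul_le_log (hmono : Monotone N) {m₀ q : ℕ} {θ b : ℝ} (hθ : 1 ≤ θ)
    (hq : 0 < q) (h₀ : 1 ≤ N m₀) (hstep : ∀ m, θ * N m ≤ N (m + q))
    (hb : b < Real.log θ / q) : ∀ᶠ m : ℕ in atTop, b * m ≤ Real.log (N m) := by
  have hq' : (0 : ℝ) < q := by exact_mod_cast hq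
  set l := Real.log θ / q with hl
  have hl0 : 0 ≤ l := div_nonneg (Real.log_nonneg hθ) hq'.le
  -- The offset m₀ and the last incomplete period cost at most l (m₀ + q), which the gap (l - b) m
  -- absorbs from here on.
  have hev : ∀ᶠ m : ℕ in atTop, l * (m₀ + q) / (l - b) ≤ (m : ℝ) :=
    tendsto_natCast_atTop_atTop.eventually_ge_atTop _
  filter_upwards [hev, eventually_ge_atTop m₀] with m hm hmm
  rw [div_le_iff₀ (by linarith)] at hm
  set k := (m - m₀) / q with hk
  have h1 : m₀ + k * q ≤ m := by
    have := Nat.div_mul_le_self (m - m₀) q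
    rw [← hk] at this
    omega
  have h2 : (m : ℝ) ≤ m₀ + q + k * q := by
    have := Nat.lt_div_mul_add (a := m - m₀) hq
    rw [← hk] at this
    have h3 : m ≤ m₀ + q + k * q := by omega
    exact_mod_cast h3
  have h3 := pow_le_of_mul_le hmono (by linarith) h₀ hstep k h1
  have h4 : k * Real.log θ ≤ Real.log (N m) := by
    rw [← Real.log_pow]
    exact Real.log_le_log (by positivity) h3
  have h5 : Real.log θ = l * q := by rw [hl]; field_simp
  rw [h5] at h4
  nlinarith [mul_le_mul_of_nonneg_left h2 hl0]

/-- Any gap between two exponents absorbs both a shift of the argument and a polynomial factor. Half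
of the gap pays for the logarithm, the other half for the constants. -/
theorem eventually_poly_lt {b b' : ℝ} (hb : b < b') (K c : ℝ) (hK : 0 < K) :
    ∀ᶠ n : ℕ in atTop, b * (n + c) + Real.log (K * ((n : ℝ) + 1) ^ 2) < b' * n := by
  have h1 : Tendsto (fun x : ℝ => Real.log x / x) atTop (𝓝 0) := by
    simpa using Real.isLittleO_log_id_atTop.tendsto_div_nhds_zero
  have hn1 : Tendsto (fun n : ℕ => (n : ℝ) + 1) atTop atTop :=
    tendsto_atTop_add_const_right _ _ tendsto_natCast_atTop_atTop
  have h2 := h1.comp hn1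
  have h3 : ∀ᶠ n : ℕ in atTop, Real.log ((n : ℝ) + 1) / ((n : ℝ) + 1) < (b' - b) / 4 :=
    h2.eventually_lt_const (by linarith)
  have h4 : ∀ᶠ n : ℕ in atTop,
      (b * c + Real.log K + (b' - b) / 2) / ((b' - b) / 2) < (n : ℝ) :=
    tendsto_natCast_atTop_atTop.eventually_gt_atTop _
  filter_upwards [h3, h4] with n h3 h4
  have hp : (0 : ℝ) < (n : ℝ) + 1 := by positivity
  rw [div_lt_iff₀ hp] at h3
  rw [div_lt_iff₀ (by linarith)] at h4
  rw [Real.log_mul hK.ne' (by positivity), Real.log_pow]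
  push_cast
  nlinarith

/-- A sequence that is supermultiplicative up to a factor that is polynomial in one of the two
arguments has a growth rate. -/
theorem limsup_logRate_le_liminf (hmono : Monotone N) {m₀ c : ℕ} {K : ℝ} (hK : 0 < K)
    (h₀ : 1 ≤ N m₀) (hsup : ∀ n m, (N n : ℝ) * N m ≤ K * ((n : ℝ) + 1) ^ 2 * N (n + m + c)) :
    limsup (fun n : ℕ => logRate (N n : ℕ∞) n) atTop ≤
      liminf (fun n : ℕ => logRate (N n : ℕ∞) n) atTop := by
  have hpos : ∀ᶠ n : ℕ in atTop, 1 ≤ N n := by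
    filter_upwards [eventually_ge_atTop m₀] with n hn
    exact h₀.trans (hmono hn)
  have hlow : ∀ b : ℝ, (∀ᶠ m : ℕ in atTop, b * m ≤ Real.log (N m)) →
      (b : EReal) ≤ liminf (fun n : ℕ => logRate (N n : ℕ∞) n) atTop := by
    intro b hb
    refine le_liminf_of_le (by isBoundedDefault) ?_
    filter_upwards [hb, hpos, eventually_gt_atTop 0] with m hm h1 h2
    rw [logRate_natCast h1, EReal.coe_le_coe_iff, le_div_iff₀ (by exact_mod_cast h2)]
    exact hm
  -- This makes the intermediate rate b nonnegative, which later gives θ ≥ 1.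
  have hnonneg : ((0 : ℝ) : EReal) ≤ liminf (fun n : ℕ => logRate (N n : ℕ∞) n) atTop := by
    refine hlow 0 (Eventually.of_forall fun m => ?_)
    simpa using Real.log_natCast_nonneg (N m)
  refine EReal.le_of_forall_lt_iff_le.1 fun b' hb' => ?_
  by_contra! hlt
  obtain ⟨b, hb, hbb'⟩ := EReal.lt_iff_exists_real_btwn.1 hb'
  have hb0 : 0 ≤ b := by exact_mod_cast (hnonneg.trans hb.le)
  rw [EReal.coe_lt_coe_iff] at hbb'
  refine hb.not_ge (hlow b ?_)
  have hfreq := frequently_lt_of_lt_limsup (by isBoundedDefault) hlt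
  obtain ⟨n, hn, h1, h2, h3⟩ := (hfreq.and_eventually (hpos.and
    ((eventually_gt_atTop 0).and (eventually_poly_lt hbb' K c hK)))).exists
  have hn' : (0 : ℝ) < n := by exact_mod_cast h2
  have hNn : (0 : ℝ) < N n := by exact_mod_cast h1
  rw [logRate_natCast h1, EReal.coe_lt_coe_iff, lt_div_iff₀ hn'] at hn
  have hD : 0 < K * ((n : ℝ) + 1) ^ 2 := by positivity
  have hlog : b * (n + c) < Real.log (N n / (K * ((n : ℝ) + 1) ^ 2)) := by
    rw [Real.log_div hNn.ne' hD.ne']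
    linarith
  have hθ0 : 0 < N n / (K * ((n : ℝ) + 1) ^ 2) := by positivity
  -- With n fixed, each advance of the argument by n + c multiplies the count by at least θ = N n /
  -- (K (n + 1)²).
  refine eventually_mul_le_log hmono (q := n + c) (m₀ := m₀) ?_ (by omega) h₀ ?_
    (b := b) (θ := N n / (K * ((n : ℝ) + 1) ^ 2)) ?_
  · have : 0 ≤ b * (n + c) := by positivity
    exact ((Real.log_pos_iff hθ0.le).1 (this.trans_lt hlog)).le
  · intro m
    rw [div_mul_eq_mul_div, div_le_iff₀ hD]
    have := hsup n m
    rw [show m + (n + c) = n + m + c by ring]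
    linarith
  · rw [lt_div_iff₀ (by positivity)]
    push_cast
    exact hlog

/-- Multiplying by a constant and shifting do not increase the growth rate. -/
theorem limsup_logRate_le_of_le {c k : ℕ} {M : ℕ → ℕ∞} (hk : 0 < k)
    (hpos : ∀ᶠ n in atTop, 1 ≤ N n) (hM : ∀ n, M n ≤ (k * N (n + c) : ℕ)) :
    limsup (fun n : ℕ => logRate (M n) n) atTop ≤
      limsup (fun n : ℕ => logRate (N n : ℕ∞) n) atTop := by
  refine EReal.le_of_forall_lt_iff_le.1 fun b' hb' => ?_
  obtain ⟨b, hb, hbb'⟩ := EReal.lt_iff_exists_real_btwn.1 hb'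
  rw [EReal.coe_lt_coe_iff] at hbb'
  have hk' : (0 : ℝ) < k := by exact_mod_cast hk
  have hshift : Tendsto (fun n : ℕ => n + c) atTop atTop := tendsto_add_atTop_nat c
  have hev := hshift.eventually ((eventually_lt_of_limsup_lt hb (by isBoundedDefault)).and hpos)
  refine limsup_le_of_le (by isBoundedDefault) ?_
  filter_upwards [hev, eventually_poly_lt hbb' k c hk', eventually_gt_atTop 0]
    with n ⟨h1, h2⟩ h3 h4
  have hn' : (0 : ℝ) < n := by exact_mod_cast h4
  have hNn : (0 : ℝ) < N (n + c) := by exact_mod_cast h2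
  rw [logRate_natCast h2, EReal.coe_lt_coe_iff, div_lt_iff₀ (by positivity)] at h1
  push_cast at h1
  refine (logRate_mono (hM n) n).trans ?_
  rw [logRate_natCast (Nat.mul_pos hk h2), EReal.coe_le_coe_iff, div_le_iff₀ hn', Nat.cast_mul,
    Real.log_mul hk'.ne' hNn.ne']
  have h5 : Real.log k ≤ Real.log (k * ((n : ℝ) + 1) ^ 2) := by
    refine Real.log_le_log hk' (le_mul_of_one_le_right hk'.le ?_)
    exact one_le_pow₀ (by linarith)
  linarith

end Growth

/-! ### Hyperbolic geometry of orbit points. -/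

section Geometry

variable {X : Type*} [MetricSpace X]

theorem dist_inv_left (g : X ≃ᵢ X) (x y : X) : dist (g⁻¹ x) y = dist x (g y) := by
  rw [← g.isometry.dist_eq, IsometryEquiv.apply_inv_self]

theorem dist_inv_inv (g : X ≃ᵢ X) (x : X) : dist (g⁻¹ x) x = dist (g x) x := by
  rw [dist_inv_left, dist_comm]

/-- Iterating `s` brings every point away from the direction of `s⁻¹ o` in at most
linearly many steps, without increasing its distance to `o`. -/
theorem exists_pow_gromovProduct_inv_le (o : X) (s : X ≃ᵢ X) (n : ℕ) :
    ∀ y : X, dist y o ≤ n → ∃ k ≤ n, dist ((s ^ k) y) o ≤ dist y o ∧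
      gromovProduct o (s⁻¹ o) ((s ^ k) y) ≤ dist (s o) o / 2 + 1 := by
  -- By invariance, twice the Gromov product of s⁻¹ o and y is |s| + d(y, o) - d(s y, o), so a large
  -- product means that s shortens y.
  have hstep : ∀ y : X, dist (s o) o / 2 + 1 < gromovProduct o (s⁻¹ o) y →
      dist (s y) o ≤ dist y o - 2 := by
    intro y hy
    rw [gromovProduct, dist_inv_inv, dist_inv_left, dist_comm o] at hy
    linarith
  induction n with
  | zero =>
    intro y hy
    refine ⟨0, le_rfl, by simp, ?_⟩
    by_contra! h
    have h1 := hstep y (by simpa using h)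
    have h2 := dist_nonneg (x := s y) (y := o)
    push_cast at hy
    linarith
  | succ n ih =>
    intro y hy
    by_cases h : gromovProduct o (s⁻¹ o) y ≤ dist (s o) o / 2 + 1
    · exact ⟨0, by omega, by simp, by simpa using h⟩
    · have h1 := hstep y (not_le.1 h)
      push_cast at hy
      obtain ⟨k, hk, h2, h3⟩ := ih (s y) (by linarith)
      refine ⟨k + 1, by omega, ?_, ?_⟩
      · rw [pow_succ, IsometryEquiv.mul_apply]
        linarith
      · rw [pow_succ, IsometryEquiv.mul_apply]
        exact h3

variable {o : X} {δ : ℝ}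

theorem gromovProduct_comm (x y : X) : gromovProduct o x y = gromovProduct o y x := by
  rw [gromovProduct, gromovProduct, dist_comm x y]
  ring

/-- If `s o` and `u s o` point in different directions and `y` is not in the direction of
`s⁻¹ o`, then no point `x` is in the direction of both `s y` and `u s y`. -/
theorem gromovProduct_le_or_le (hδ0 : 0 ≤ δ)
    (hδ : ∀ x y z : X, min (gromovProduct o x y) (gromovProduct o y z) - δ ≤ gromovProduct o x z)
    {s u : X ≃ᵢ X}
    (h : gromovProduct o (s o) (u (s o)) + dist (u o) o + (2 * δ + 1) < dist (s o) o / 2)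
    {y : X} (hy : gromovProduct o (s⁻¹ o) y ≤ dist (s o) o / 2 + 1) (x : X) :
    gromovProduct o x (s y) ≤ gromovProduct o (s o) (u (s o)) + 3 * δ ∨
      gromovProduct o x (u (s y)) ≤ gromovProduct o (s o) (u (s o)) + 3 * δ := by
  set C := gromovProduct o (s o) (u (s o)) with hC
  by_contra! hx
  have h1 := hδ (s y) x (u (s y))
  rw [gromovProduct_comm (s y) x] at h1
  have h2 : C + 2 * δ < gromovProduct o (s y) (u (s y)) := by
    have := lt_min hx.1 hx.2
    linarith
  -- Since s shortens y by at most 2, the point s y lies in the direction of s o. Applying u costs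
  -- at most |u|, so the chain s o, s y, u s y, u s o would force a product larger than C between
  -- its ends.
  have h3 : dist (s o) o / 2 - 1 ≤ gromovProduct o (s o) (s y) := by
    rw [gromovProduct, dist_inv_inv, dist_inv_left, dist_comm o] at hy
    rw [gromovProduct, s.isometry.dist_eq, dist_comm o]
    linarith
  have h4 : gromovProduct o (s o) (s y) - dist (u o) o ≤
      gromovProduct o (u (s y)) (u (s o)) := by
    have h5 := dist_triangle (u (s y)) (u o) o
    have h6 := dist_triangle_right (u (s y)) (u o) o
    have h7 := dist_triangle_right (u (s o)) (u o) o
    simp only [gromovProduct, u.isometry.dist_eq] at h5 h6 h7 ⊢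
    rw [dist_comm (s y) (s o)]
    linarith
  have h5 := hδ (s o) (u (s y)) (u (s o))
  have h6 := hδ (s o) (s y) (u (s y))
  rcases min_choice (gromovProduct o (s o) (u (s y)))
    (gromovProduct o (u (s y)) (u (s o))) with h7 | h7 <;>
  rcases min_choice (gromovProduct o (s o) (s y))
    (gromovProduct o (s y) (u (s y))) with h8 | h8 <;>
  rw [h7] at h5 <;> rw [h8] at h6 <;> linarith [dist_nonneg (x := u o) (y := o)]

/-- If `o, γᵢ o, γᵢ wᵢ` are nearly aligned, the points `γᵢ wᵢ` are close and the `wᵢ` are nearly at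
the same distance of `o`, then the points `γᵢ o` are close. -/
theorem dist_le_of_aligned (hδ0 : 0 ≤ δ)
    (hδ : ∀ x y z : X, min (gromovProduct o x y) (gromovProduct o y z) - δ ≤ gromovProduct o x z)
    {γ₁ γ₂ : X ≃ᵢ X} {w₁ w₂ : X} {C R a : ℝ} (hC : 0 ≤ C) (hR : 0 ≤ R)
    (ha : |dist w₁ o - dist w₂ o| ≤ a)
    (h₁ : gromovProduct o (γ₁⁻¹ o) w₁ ≤ C) (h₂ : gromovProduct o (γ₂⁻¹ o) w₂ ≤ C)
    (hp : dist (γ₁ w₁) (γ₂ w₂) ≤ R) :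
    dist (γ₁ o) (γ₂ o) ≤ 8 * C + 5 * R + 3 * a + 4 * δ := by
  have ha0 := (abs_nonneg _).trans ha
  obtain ⟨ha1, ha2⟩ := abs_le.1 ha
  have e1 := dist_triangle (γ₁ w₁) (γ₁ o) o
  have e2 := dist_triangle (γ₂ w₂) (γ₂ o) o
  have e3 := dist_triangle (γ₁ w₁) (γ₂ w₂) o
  have e4 := dist_triangle_left (γ₂ w₂) o (γ₁ w₁)
  -- The chain γ₁ o, γ₁ w₁, γ₂ w₂, γ₂ o bounds the product of its ends from below; alignment makes
  -- the distances of γ₁ o and γ₂ o to o nearly equal.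
  have k1 := hδ (γ₁ o) (γ₁ w₁) (γ₂ w₂)
  have k2 := hδ (γ₁ o) (γ₂ w₂) (γ₂ o)
  simp only [gromovProduct, dist_inv_inv, dist_inv_left, IsometryEquiv.dist_eq] at *
  rw [dist_comm o (γ₁ w₁)] at h₁
  rw [dist_comm o (γ₂ w₂)] at h₂
  rw [dist_comm o w₁] at k1
  rcases min_choice ((dist (γ₁ o) o + dist (γ₁ w₁) o - dist w₁ o) / 2)
    ((dist (γ₁ w₁) o + dist (γ₂ w₂) o - dist (γ₁ w₁) (γ₂ w₂)) / 2) with h7 | h7 <;>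
  rcases min_choice ((dist (γ₁ o) o + dist (γ₂ w₂) o - dist (γ₁ o) (γ₂ w₂)) / 2)
    ((dist (γ₂ w₂) o + dist (γ₂ o) o - dist w₂ o) / 2) with h8 | h8 <;>
  rw [h7] at k1 <;> rw [h8] at k2 <;>
  linarith [dist_nonneg (x := w₁) (y := o), dist_nonneg (x := w₂) (y := o)]

/-- Two points near the line from `x` to `z` are close if their distances to `x` are. -/
theorem dist_le_of_near_line
    (hδ : ∀ x y z : X, min (gromovProduct o x y) (gromovProduct o y z) - δ ≤ gromovProduct o x z)
    {γ₁ γ₂ : X ≃ᵢ X} {x z : X} {B : ℝ} (hB : 0 ≤ B)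
    (h₁ : dist x (γ₁ o) + dist z (γ₁ o) ≤ dist x z + 2 * B)
    (h₂ : dist x (γ₂ o) + dist z (γ₂ o) ≤ dist x z + 2 * B)
    (h : |dist x (γ₁ o) - dist x (γ₂ o)| ≤ 1) :
    dist (γ₁ o) (γ₂ o) ≤ 4 * B + 2 * δ + 1 := by
  obtain ⟨h3, h4⟩ := abs_le.1 h
  -- Seen from γ₁ o, the product of x and z is at most B, so γ₂ o has product at most B + δ with one
  -- of them.
  have k := hδ (γ₁⁻¹ x) (γ₁⁻¹ (γ₂ o)) (γ₁⁻¹ z)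
  have t := dist_triangle_right x z (γ₁ o)
  have t2 := dist_triangle_right x z (γ₂ o)
  simp only [gromovProduct, dist_inv_left, IsometryEquiv.apply_inv_self] at k
  rw [dist_comm (γ₂ o) (γ₁ o), dist_comm (γ₂ o) z] at k
  rcases min_choice ((dist x (γ₁ o) + dist (γ₁ o) (γ₂ o) - dist x (γ₂ o)) / 2)
    ((dist (γ₁ o) (γ₂ o) + dist z (γ₁ o) - dist z (γ₂ o)) / 2) with h7 | h7 <;>
  rw [h7] at k <;> linarith

/-- If `u` nearly preserves the directions of `x` and `z`, then `u o` is near the line from `x`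
to `z`. -/
theorem near_line_of_gromovProduct_le (hδ0 : 0 ≤ δ)
    (hδ : ∀ x y z : X, min (gromovProduct o x y) (gromovProduct o y z) - δ ≤ gromovProduct o x z)
    {u : X ≃ᵢ X} {x z : X} {b : ℝ} (hxz : gromovProduct o x z ≤ b)
    (hx : b + 2 * δ + dist (u o) o < gromovProduct o x (u x))
    (hz : b + 2 * δ + dist (u o) o < gromovProduct o z (u z)) :
    dist x (u o) + dist z (u o) ≤ dist x z + 2 * (b + 2 * δ) := by
  have hinv : ∀ y : X, gromovProduct o y (u y) - dist (u o) o ≤ gromovProduct o y (u⁻¹ y) := by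
    intro y
    have h1 := dist_triangle (u y) (u o) o
    have h2 := dist_triangle_right y (u o) o
    have h3 := dist_triangle y (u o) o
    simp only [gromovProduct, dist_comm y (u⁻¹ y), dist_inv_left, IsometryEquiv.dist_eq] at *
    linarith
  have hx' := hinv x
  have hz' := hinv z
  have k1 := hδ x (u⁻¹ x) z
  have k2 := hδ (u⁻¹ x) (u⁻¹ z) z
  rw [gromovProduct_comm (u⁻¹ z) z] at k2
  -- Twice this product is the excess in the conclusion. As u⁻¹ also nearly preserves both
  -- directions, a larger value would make the product of x and z exceed b.
  have key : gromovProduct o (u⁻¹ x) (u⁻¹ z) ≤ b + 2 * δ := by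
    by_contra! hlt
    rcases min_choice (gromovProduct o x (u⁻¹ x)) (gromovProduct o (u⁻¹ x) z) with h7 | h7 <;>
    rcases min_choice (gromovProduct o (u⁻¹ x) (u⁻¹ z)) (gromovProduct o z (u⁻¹ z))
      with h8 | h8 <;>
    rw [h7] at k1 <;> rw [h8] at k2 <;> linarith
  simp only [gromovProduct, dist_inv_left, IsometryEquiv.apply_inv_self] at key
  linarith

end Geometry

/-! ### Displacement counts: the transverse case and the linear case. -/

section Orbits

variable {X : Type*} [MetricSpace X]

/-- The elements of `S` that move `o` by at most `n`. -/
def displacementBall (o : X) (S : Set (X ≃ᵢ X)) (n : ℕ) : Set (X ≃ᵢ X) :=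
  {γ ∈ S | dist o (γ o) ≤ (n : ℝ)}

variable {o : X} {S : Set (X ≃ᵢ X)} {ε δ : ℝ}

theorem SeparatedIsom.exists_pairwise (hS : SeparatedIsom o S) :
    ∃ ε : ℝ, 0 < ε ∧ S.Pairwise fun γ γ' => ε < dist (γ o) (γ' o) := by
  obtain ⟨⟨ε, hε, hP⟩, hinj⟩ := hS
  exact ⟨ε, hε, fun γ hγ γ' hγ' hne =>
    hP (mem_image_of_mem _ hγ) (mem_image_of_mem _ hγ') fun h => hne (hinj hγ hγ' h)⟩

theorem displacementBall_mono (o : X) (S : Set (X ≃ᵢ X)) : Monotone (displacementBall o S) :=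
  fun _ _ h _ hγ => ⟨hγ.1, hγ.2.trans (by exact_mod_cast h)⟩

theorem encard_closedBall_inter_orbit (hS : SeparatedIsom o S) (n : ℕ) :
    (Metric.closedBall o (n : ℝ) ∩ orbit o S).encard = (displacementBall o S n).encard := by
  have h : Metric.closedBall o (n : ℝ) ∩ orbit o S =
      (fun γ : X ≃ᵢ X => γ o) '' displacementBall o S n := by
    ext x
    constructor
    · rintro ⟨hx, γ, hγ, rfl⟩
      exact ⟨γ, ⟨hγ, by simpa [dist_comm] using hx⟩, rfl⟩
    · rintro ⟨γ, ⟨hγ, h⟩, rfl⟩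
      exact ⟨by simpa [dist_comm] using h, γ, hγ, rfl⟩
  rw [h, (hS.2.mono fun γ hγ => hγ.1).encard_image]

variable [ProperSpace X]

theorem finite_displacementBall (hε : 0 < ε)
    (hS : S.Pairwise fun γ γ' => ε < dist (γ o) (γ' o)) (n : ℕ) :
    (displacementBall o S n).Finite := by
  obtain ⟨K, hK⟩ := exists_encard_le_of_separated (ι := X ≃ᵢ X) o hε n
  refine finite_of_encard_le_coe (hK (fun γ => γ o) _ (hS.mono fun γ hγ => hγ.1) 1 ?_)
  exact fun γ hγ => hγ.2

/-- If `s` and `u s` move `o` far enough in different directions, then the displacement counts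
are supermultiplicative up to a polynomial factor. -/
theorem exists_mul_le_of_transverse (hδ0 : 0 ≤ δ)
    (hδ : ∀ x y z : X, min (gromovProduct o x y) (gromovProduct o y z) - δ ≤ gromovProduct o x z)
    {Γ : Subsemigroup (X ≃ᵢ X)} (hSΓ : S ⊆ Γ) (hε : 0 < ε)
    (hS : S.Pairwise fun γ γ' => ε < dist (γ o) (γ' o))
    (hcov : CoveringIsom o S Γ) {s u : X ≃ᵢ X} (hs : s ∈ Γ) (hu : u ∈ Γ)
    (h : gromovProduct o (s o) (u (s o)) + dist (u o) o + (2 * δ + 1) < dist (s o) o / 2) :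
    ∃ K c : ℕ, ∀ n m : ℕ, (displacementBall o S n).ncard * (displacementBall o S m).ncard ≤
      K * (n + 1) ^ 2 * (displacementBall o S (n + m + c)).ncard := by
  obtain ⟨R, hR, hcov⟩ := hcov
  set C := max 0 (gromovProduct o (s o) (u (s o)) + 3 * δ) with hC
  set V := dist (s o) o + dist (u o) o with hV
  obtain ⟨c, hc⟩ := exists_nat_ge (V + R)
  -- Here 2 * R compares two points near the same σ o, and 2 * V + 1 compares two lengths with equal
  -- integer part after applying the same connector.
  obtain ⟨K₁, hK₁⟩ := exists_encard_le_of_separated (ι := X ≃ᵢ X) o hε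
    (8 * C + 5 * (2 * R) + 3 * (2 * V + 1) + 4 * δ)
  obtain ⟨K₂, hK₂⟩ := exists_encard_le_of_separated (ι := X ≃ᵢ X) o hε (2 * R)
  refine ⟨K₂ * K₁ * 2, c, fun n m => ?_⟩
  have hfin := finite_displacementBall hε hS
  set v : Bool → X ≃ᵢ X := fun b => cond b s (u * s) with hv
  have hvΓ : ∀ b, v b ∈ Γ := by
    rintro (_ | _)
    exacts [Γ.mul_mem hu hs, hs]
  have hvV : ∀ b x, |dist (v b x) o - dist x o| ≤ V := by
    have hg : ∀ (g : X ≃ᵢ X) x, |dist (g x) o - dist x o| ≤ dist (g o) o := by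
      intro g x
      have := abs_dist_sub_le (g o) o (g x)
      rwa [g.isometry.dist_eq, dist_comm o x, dist_comm o (g x), abs_sub_comm] at this
    rintro (_ | _) x
    · have h1 := hg s x
      have h2 := hg u (s x)
      simp only [hv, cond_false, IsometryEquiv.mul_apply]
      calc _ ≤ |dist (u (s x)) o - dist (s x) o| + |dist (s x) o - dist x o| := abs_sub_le _ _ _
        _ ≤ V := by linarith
    · exact (hg s x).trans (by simp [hV])
  have hpow : ∀ k, ∀ γ ∈ Γ, s ^ k * γ ∈ Γ := by
    intro k γ hγ
    induction k with
    | zero => simpa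
    | succ k ih =>
      rw [pow_succ', mul_assoc]
      exact Γ.mul_mem hs ih
  -- A label records k, the connector, the integer part of |s^k γ'| and an element σ of S near the
  -- product. Both integers are at most n, which is the source of (n + 1)².
  have hlabel : ∀ p : (X ≃ᵢ X) × (X ≃ᵢ X), ∃ l : (ℕ × Bool) × ℕ × (X ≃ᵢ X),
      p ∈ displacementBall o S n ×ˢ displacementBall o S m →
      l ∈ ((Finset.range (n + 1) : Set ℕ) ×ˢ (univ : Set Bool)) ×ˢ
        ((Finset.range (n + 1) : Set ℕ) ×ˢ displacementBall o S (n + m + c)) ∧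
      (l.2.1 : ℝ) ≤ dist ((s ^ l.1.1) (p.1 o)) o ∧
      dist ((s ^ l.1.1) (p.1 o)) o ≤ l.2.1 + 1 ∧
      gromovProduct o (p.2⁻¹ o) (v l.1.2 ((s ^ l.1.1) (p.1 o))) ≤ C ∧
      dist (l.2.2 o) (p.2 (v l.1.2 ((s ^ l.1.1) (p.1 o)))) ≤ R := by
    rintro ⟨γ', γ⟩
    by_cases hp : (γ', γ) ∈ displacementBall o S n ×ˢ displacementBall o S m
    swap
    · exact ⟨((0, true), 0, 1), fun h => absurd h hp⟩
    obtain ⟨⟨hγ'S, hγ'⟩, hγS, hγ⟩ := hp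
    dsimp only at hγ hγ' hγS hγ'S
    rw [dist_comm] at hγ hγ'
    obtain ⟨k, hk, hk1, hk2⟩ := exists_pow_gromovProduct_inv_le o s n (γ' o) hγ'
    obtain ⟨b, hb⟩ : ∃ b, gromovProduct o (γ⁻¹ o) (v b ((s ^ k) (γ' o))) ≤ C := by
      rcases gromovProduct_le_or_le hδ0 hδ h hk2 (γ⁻¹ o) with h1 | h1
      · exact ⟨true, h1.trans (le_max_right _ _)⟩
      · exact ⟨false, h1.trans (le_max_right _ _)⟩
    have hmem : γ * (v b * (s ^ k * γ')) ∈ Γ :=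
      Γ.mul_mem (hSΓ hγS) (Γ.mul_mem (hvΓ b) (hpow k γ' (hSΓ hγ'S)))
    obtain ⟨_, ⟨σ, hσ, rfl⟩, hσR⟩ := hcov _ (mem_image_of_mem (fun g : X ≃ᵢ X => g o) hmem)
    simp only [IsometryEquiv.mul_apply] at hσR
    refine ⟨((k, b), ⌊dist ((s ^ k) (γ' o)) o⌋₊, σ), fun _ => ⟨?_, ?_, ?_, hb, hσR⟩⟩
    · simp only [mem_prod, Finset.coe_range, mem_Iio, mem_univ, and_true]
      refine ⟨by omega, ?_, hσ, ?_⟩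
      · have := Nat.floor_mono (hk1.trans hγ')
        rw [Nat.floor_natCast] at this
        omega
      · have h1 := dist_triangle (γ (v b ((s ^ k) (γ' o)))) (γ o) o
        have h2 := dist_triangle_left o (σ o) (γ (v b ((s ^ k) (γ' o))))
        rw [γ.isometry.dist_eq] at h1
        rw [dist_comm (γ (v b ((s ^ k) (γ' o)))) (σ o)] at h2
        have h3 := (abs_le.1 (hvV b ((s ^ k) (γ' o)))).2
        push_cast
        linarith
    · exact Nat.floor_le dist_nonneg
    · exact (Nat.lt_floor_add_one _).le
  choose l hl using hlabel
  have hfinP := (hfin n).prod (hfin m)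
  have hcard := ncard_le_mul_of_fiber_le hfinP
    (((Finset.finite_toSet (Finset.range (n + 1))).prod (finite_univ (α := Bool))).prod
      ((Finset.finite_toSet (Finset.range (n + 1))).prod (hfin (n + m + c))))
    l (fun p hp => (hl p hp).1) (K₂ * K₁) ?_
  · simp only [ncard_prod, ncard_coe_finset, Finset.card_range, ncard_univ, Nat.card_eq_fintype_card,
      Fintype.card_bool] at hcard
    refine hcard.trans (le_of_eq ?_)
    ring
  · intro b _
    set F := {p ∈ displacementBall o S n ×ˢ displacementBall o S m | l p = b} with hF
    have hFfin : F.Finite := hfinP.subset (sep_subset _ _)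
    have hclose : ∀ p ∈ F, ∀ q ∈ F,
        dist (p.2 (v b.1.2 ((s ^ b.1.1) (p.1 o)))) (q.2 (v b.1.2 ((s ^ b.1.1) (q.1 o))))
          ≤ 2 * R := by
      rintro p ⟨hp, hpb⟩ q ⟨hq, hqb⟩
      obtain ⟨-, -, -, -, h1⟩ := hl p hp
      obtain ⟨-, -, -, -, h2⟩ := hl q hq
      rw [hpb] at h1
      rw [hqb] at h2
      linarith [dist_triangle_left (p.2 (v b.1.2 ((s ^ b.1.1) (p.1 o))))
        (q.2 (v b.1.2 ((s ^ b.1.1) (q.1 o)))) (b.2.2 o)]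
    -- Within a fibre, alignment first leaves at most K₁ values of γ. With γ fixed, the common
    -- isometry γ v s^k drops out of distances and leaves at most K₂ values of γ'.
    have h1 := ncard_le_mul_of_fiber_le hFfin (hFfin.image Prod.snd) Prod.snd
      (fun p hp => mem_image_of_mem _ hp) K₂ ?_
    · refine h1.trans (Nat.mul_le_mul_left _ ?_)
      rcases F.eq_empty_or_nonempty with hemp | ⟨p, hp⟩
      · simp [hemp]
      rw [← Nat.cast_le (α := ℕ∞), (hFfin.image Prod.snd).cast_ncard_eq]
      refine hK₁ (fun γ => γ o) _ (hS.mono ?_) p.2 ?_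
      · rintro _ ⟨q, hq, rfl⟩
        exact hq.1.2.1
      · rintro _ ⟨q, hq, rfl⟩
        have hpq := hclose p hp q hq
        obtain ⟨hp, hpb⟩ := hp
        obtain ⟨hq, hqb⟩ := hq
        obtain ⟨-, h2, h3, h4, -⟩ := hl p hp
        obtain ⟨-, k2, k3, k4, -⟩ := hl q hq
        rw [hpb] at h2 h3 h4
        rw [hqb] at k2 k3 k4
        refine dist_le_of_aligned hδ0 hδ (le_max_left _ _) (by positivity) ?_ h4 k4 hpq
        have a1 := abs_le.1 (hvV b.1.2 ((s ^ b.1.1) (p.1 o)))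
        have a2 := abs_le.1 (hvV b.1.2 ((s ^ b.1.1) (q.1 o)))
        rw [abs_le]
        constructor <;> linarith [a1.1, a1.2, a2.1, a2.2]
    · rintro γ -
      set E := {p ∈ F | p.2 = γ} with hE
      have hEfin : E.Finite := hFfin.subset (sep_subset _ _)
      have hinj : InjOn Prod.fst E := fun p hp q hq hpq => Prod.ext hpq (hp.2.trans hq.2.symm)
      rw [← hinj.ncard_image]
      rcases E.eq_empty_or_nonempty with hemp | ⟨p, hp⟩
      · simp [hemp]
      rw [← Nat.cast_le (α := ℕ∞), (hEfin.image Prod.fst).cast_ncard_eq]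
      refine hK₂ (fun γ => γ o) _ (hS.mono ?_) p.1 ?_
      · rintro _ ⟨q, hq, rfl⟩
        exact hq.1.1.1.1
      · rintro _ ⟨q, hq, rfl⟩
        have hpq := hclose p hp.1 q hq.1
        rw [hp.2, hq.2] at hpq
        simpa only [IsometryEquiv.dist_eq] using hpq

/-- If no `s` and `u s` in `Γ` move `o` far in different directions, and the limit set
has two points, then the displacement counts grow at most linearly. -/
theorem exists_ncard_le_of_not_transverse (hδ0 : 0 ≤ δ)
    (hδ : ∀ x y z : X, min (gromovProduct o x y) (gromovProduct o y z) - δ ≤ gromovProduct o x z)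
    {Γ : Subsemigroup (X ≃ᵢ X)} (hΓ : Nontrivial (LimitSet o Γ)) (hSΓ : S ⊆ Γ) (hε : 0 < ε)
    (hS : S.Pairwise fun γ γ' => ε < dist (γ o) (γ' o)) {L : ℝ}
    (h : ∀ s ∈ Γ, ∀ u ∈ Γ,
      dist (s o) o / 2 ≤ gromovProduct o (s o) (u (s o)) + dist (u o) o + L) :
    ∃ K : ℕ, ∀ n : ℕ, (displacementBall o S n).ncard ≤ K * (2 * n + 1) := by
  obtain ⟨⟨x⟩, ⟨y⟩, hxy⟩ := hΓ
  have hxy' : ¬ boundaryRel o _ x y := fun hr => hxy (Quot.sound hr)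
  rw [boundaryRel, tendsto_atTop] at hxy'
  push Not at hxy'
  obtain ⟨b, hb⟩ := hxy'
  have hlarge : ∀ (x : ConvergentSeq o (orbit o (Γ : Set (X ≃ᵢ X)))) (a : ℝ),
      ∃ i, ∀ j ≥ i, a ≤ dist (x.1 j) o := by
    intro x a
    obtain ⟨p, hp⟩ := eventually_atTop.1 (tendsto_atTop.1 x.2.2 a)
    refine ⟨p.1 ⊔ p.2, fun j hj => ?_⟩
    have := hp (j, j) ⟨le_sup_left.trans hj, le_sup_right.trans hj⟩
    simp only [gromovProduct, dist_self] at this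
    linarith
  set B := max 0 (max 0 b + 2 * δ) with hB
  obtain ⟨K, hK⟩ := exists_encard_le_of_separated (ι := X ≃ᵢ X) o hε (4 * B + 2 * δ + 1)
  refine ⟨K, fun n => ?_⟩
  -- The two summands n cover the |u| lost in the hypothesis `h` and the |u| required by
  -- `near_line_of_gromovProduct_le`. The distant points depend on n, but B and K do not.
  set a : ℝ := 2 * (max 0 b + 2 * δ + 2 * n + L) + 1 with ha
  obtain ⟨i₀, hi₀⟩ := hlarge x a
  obtain ⟨j₀, hj₀⟩ := hlarge y a
  obtain ⟨⟨i, j⟩, hij, hlt⟩ := frequently_atTop.1 hb (i₀, j₀)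
  have hi := hi₀ i hij.1
  have hj := hj₀ j hij.2
  obtain ⟨s, hs, hsx⟩ := x.2.1 i
  obtain ⟨t, ht, hty⟩ := y.2.1 j
  dsimp only at hlt hsx hty
  rw [← hsx] at hi hlt
  rw [← hty] at hj hlt
  have hline : ∀ u ∈ displacementBall o S n,
      dist (s o) (u o) + dist (t o) (u o) ≤ dist (s o) (t o) + 2 * B := by
    rintro u ⟨huS, hun⟩
    rw [dist_comm] at hun
    have h1 := h s hs u (hSΓ huS)
    have h2 := h t ht u (hSΓ huS)
    refine (near_line_of_gromovProduct_le hδ0 hδ (hlt.le.trans (le_max_right 0 b))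
      (by linarith) (by linarith)).trans ?_
    linarith [le_max_right 0 (max 0 b + 2 * δ)]
  have hdist : ∀ u ∈ displacementBall o S n, dist (s o) o - n ≤ dist (s o) (u o) ∧
      dist (s o) (u o) ≤ dist (s o) o + n := by
    rintro u ⟨-, hun⟩
    have h1 := dist_triangle (s o) o (u o)
    have h2 := dist_triangle_right (s o) o (u o)
    exact ⟨by linarith, by linarith⟩
  -- The distances from s o lie in an interval of length 2n, hence in 2n + 1 unit bins; near the
  -- line, each bin holds at most K elements.
  have hcard := ncard_le_mul_of_fiber_le (finite_displacementBall hε hS n)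
    (Finset.finite_toSet (Finset.range (2 * n + 1)))
    (fun u => ⌊dist (s o) (u o) - (dist (s o) o - n)⌋₊) ?_ K ?_
  · simpa using hcard
  · intro u hu
    have h1 : dist (s o) (u o) - (dist (s o) o - n) ≤ (2 * n : ℕ) := by
      push_cast
      linarith [(hdist u hu).2]
    have h2 := Nat.floor_mono h1
    rw [Nat.floor_natCast] at h2
    simp only [Finset.coe_range, mem_Iio]
    omega
  · intro k _
    set F := {u ∈ displacementBall o S n | ⌊dist (s o) (u o) - (dist (s o) o - n)⌋₊ = k} with hF
    have hFfin : F.Finite := (finite_displacementBall hε hS n).subset (sep_subset _ _)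
    rcases F.eq_empty_or_nonempty with hemp | ⟨u, hu⟩
    · simp [hemp]
    rw [← Nat.cast_le (α := ℕ∞), hFfin.cast_ncard_eq]
    refine hK (fun γ => γ o) F (hS.mono fun γ hγ => hγ.1.1) u fun w hw => ?_
    refine dist_le_of_near_line hδ (le_max_left _ _) (hline u hu.1) (hline w hw.1) ?_
    have u1 := Nat.floor_le (sub_nonneg.2 (hdist u hu.1).1)
    have u2 := Nat.lt_floor_add_one (dist (s o) (u o) - (dist (s o) o - n))
    have w1 := Nat.floor_le (sub_nonneg.2 (hdist w hw.1).1)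
    have w2 := Nat.lt_floor_add_one (dist (s o) (w o) - (dist (s o) o - n))
    rw [hu.2] at u1 u2
    rw [hw.2] at w1 w2
    rw [abs_le]
    constructor <;> linarith

theorem exists_mul_le (hX : IsGromovHyperbolic o) {Γ : Subsemigroup (X ≃ᵢ X)}
    (hΓ : Nontrivial (LimitSet o Γ)) (hSΓ : S ⊆ Γ) (hε : 0 < ε)
    (hS : S.Pairwise fun γ γ' => ε < dist (γ o) (γ' o)) (hcov : CoveringIsom o S Γ) :
    ∃ K c : ℕ, ∀ n m : ℕ, (displacementBall o S n).ncard * (displacementBall o S m).ncard ≤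
      K * (n + 1) ^ 2 * (displacementBall o S (n + m + c)).ncard := by
  obtain ⟨δ, hδ0, hδ⟩ := hX
  by_cases h : ∃ s ∈ Γ, ∃ u ∈ Γ,
      gromovProduct o (s o) (u (s o)) + dist (u o) o + (2 * δ + 1) < dist (s o) o / 2
  · obtain ⟨s, hs, u, hu, h⟩ := h
    exact exists_mul_le_of_transverse hδ0 hδ hSΓ hε hS hcov hs hu h
  · push Not at h
    obtain ⟨K, hK⟩ := exists_ncard_le_of_not_transverse hδ0 hδ hΓ hSΓ hε hS h
    refine ⟨2 * K, 0, fun n m => Nat.mul_le_mul ((hK n).trans ?_) ?_⟩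
    · nlinarith [Nat.zero_le (K * n), Nat.zero_le (K * n ^ 2)]
    · exact ncard_le_ncard (displacementBall_mono o S (by omega)) (finite_displacementBall hε hS _)

/-! ### Entropy and existence of the limit. -/

/-- The counts of a separated subset of the orbit are controlled by those of a covering one. -/
theorem exists_encard_closedBall_le {Γ : Set (X ≃ᵢ X)} (hε : 0 < ε)
    (hS : S.Pairwise fun γ γ' => ε < dist (γ o) (γ' o)) (hcov : CoveringIsom o S Γ) {P : Set X}
    (hP : Separated P) :
    ∃ k c : ℕ, 0 < k ∧ ∀ n : ℕ, (Metric.closedBall o (n : ℝ) ∩ (orbit o Γ ∩ P)).encard ≤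
      (k * (displacementBall o S (n + c)).ncard : ℕ) := by
  obtain ⟨R, hR, hcov⟩ := hcov
  obtain ⟨η, hη, hP⟩ := hP
  obtain ⟨c, hc⟩ := exists_nat_ge R
  obtain ⟨K, hK⟩ := exists_encard_le_of_separated (ι := X) o hη R
  refine ⟨K + 1, c, by omega, fun n => ?_⟩
  set A := Metric.closedBall o (n : ℝ) ∩ (orbit o Γ ∩ P) with hA
  have hAP : A ⊆ P := fun x hx => hx.2.2
  have hAfin : A.Finite := by
    obtain ⟨K', hK'⟩ := exists_encard_le_of_separated (ι := X) o hη n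
    refine finite_of_encard_le_coe (hK' (fun x => x) A (hP.mono hAP) 1 fun x hx => ?_)
    simpa [dist_comm] using hx.1
  have hnear : ∀ x, ∃ σ : X ≃ᵢ X, x ∈ A → σ ∈ S ∧ dist (σ o) x ≤ R := by
    intro x
    by_cases hx : x ∈ A
    · obtain ⟨_, ⟨σ, hσ, rfl⟩, h⟩ := hcov x hx.2.1
      exact ⟨σ, fun _ => ⟨hσ, h⟩⟩
    · exact ⟨1, fun h => absurd h hx⟩
  choose f hf using hnear
  rw [← hAfin.cast_ncard_eq, Nat.cast_le]
  refine ncard_le_mul_of_fiber_le hAfin (finite_displacementBall hε hS _) f ?_ _ ?_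
  · intro x hx
    refine ⟨(hf x hx).1, ?_⟩
    have h1 := dist_triangle_right o (f x o) x
    have h2 := (hf x hx).2
    have h3 : dist o x ≤ n := by simpa [dist_comm] using hx.1
    push_cast
    linarith
  · intro σ _
    have hfin : {x ∈ A | f x = σ}.Finite := hAfin.subset (sep_subset _ _)
    refine le_trans ?_ (Nat.le_succ K)
    rw [← Nat.cast_le (α := ℕ∞), hfin.cast_ncard_eq]
    refine hK (fun x => x) _ (hP.mono fun x hx => hAP hx.1) σ fun x hx => ?_
    have := (hf x hx.1).2
    rwa [hx.2] at this

/-- The entropy is the critical exponent of any separated covering subset. -/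
theorem entropyIsom_eq_limsup {Γ : Set (X ≃ᵢ X)} (hSΓ : S ⊆ Γ) (hne : S.Nonempty)
    (hS : SeparatedIsom o S) (hcov : CoveringIsom o S Γ) :
    entropyIsom o Γ =
      limsup (fun n : ℕ => logRate (displacementBall o S n).encard n) atTop := by
  obtain ⟨ε, hε, hpw⟩ := hS.exists_pairwise
  have hfin := finite_displacementBall hε hpw
  have horb : orbit o S ⊆ orbit o Γ := image_mono hSΓ
  have hΓne : orbit o Γ ≠ ∅ := ((hne.image _).mono horb).ne_empty
  rw [entropyIsom, entropy, if_neg hΓne]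
  refine le_antisymm (iSup_le fun P => ?_) ?_
  · obtain ⟨k, c, hk, h⟩ := exists_encard_closedBall_le hε hpw hcov P.2
    have hpos : ∀ᶠ n in atTop, 1 ≤ (displacementBall o S n).ncard := by
      obtain ⟨γ, hγ⟩ := hne
      obtain ⟨m, hm⟩ := exists_nat_ge (dist o (γ o))
      filter_upwards [eventually_ge_atTop m] with n hn
      exact (ncard_pos (hfin n)).2 ⟨γ, hγ, hm.trans (by exact_mod_cast hn)⟩
    refine (limsup_logRate_le_of_le hk hpos h).trans (le_of_eq ?_)
    simp only [(hfin _).cast_ncard_eq]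
  -- The orbit of S is itself one of the separated sets in the supremum.
  · refine le_trans (le_of_eq ?_) (le_iSup _ ⟨orbit o S, hS.1⟩)
    rw [criticalExponent, inter_eq_self_of_subset_right horb]
    simp only [encard_closedBall_inter_orbit hS]

theorem tendsto_logRate (hX : IsGromovHyperbolic o) {Γ : Subsemigroup (X ≃ᵢ X)}
    (hΓ : Nontrivial (LimitSet o Γ)) (hSΓ : S ⊆ Γ) (hS : SeparatedIsom o S)
    (hcov : CoveringIsom o S Γ) :
    Tendsto (fun n : ℕ => logRate (displacementBall o S n).encard n) atTop
      (𝓝 (entropyIsom o (Γ : Set (X ≃ᵢ X)))) := by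
  obtain ⟨ε, hε, hpw⟩ := hS.exists_pairwise
  have hfin := finite_displacementBall hε hpw
  -- Nonemptiness excludes the conventional entropy 0 of the empty set; a limit point supplies an
  -- orbit point, and covering then an element of S.
  have hne : S.Nonempty := by
    obtain ⟨R, -, hR⟩ := hcov
    obtain ⟨⟨x⟩, -⟩ := hΓ
    obtain ⟨_, ⟨σ, hσ, -⟩, -⟩ := hR _ (x.2.1 0)
    exact ⟨σ, hσ⟩
  obtain ⟨γ, hγ⟩ := hne
  obtain ⟨m₀, hm₀⟩ := exists_nat_ge (dist o (γ o))
  obtain ⟨K, c, hK⟩ := exists_mul_le hX hΓ hSΓ hε hpw hcov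
  have hle := limsup_logRate_le_liminf (N := fun n => (displacementBall o S n).ncard)
    (m₀ := m₀) (c := c) (K := K + 1)
    (fun _ _ h => ncard_le_ncard (displacementBall_mono o S h) (hfin _)) (by positivity)
    ((ncard_pos (hfin m₀)).2 ⟨γ, hγ, hm₀⟩) (fun n m => by
      have h1 : (displacementBall o S n).ncard * (displacementBall o S m).ncard ≤
          (K + 1) * (n + 1) ^ 2 * (displacementBall o S (n + m + c)).ncard :=
        (hK n m).trans (by gcongr; omega)
      exact_mod_cast h1)
  simp only [(hfin _).cast_ncard_eq] at hle
  have heq := entropyIsom_eq_limsup hSΓ ⟨γ, hγ⟩ hS hcov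
  exact tendsto_of_le_liminf_of_limsup_le (heq.trans_le hle) heq.ge

end Orbits

end HypIsom

theorem mainTheorem6 {X : Type*} [MetricSpace X] [ProperSpace X] (o : X)
    (hX : HypIsom.IsGromovHyperbolic o) (Γ : Subsemigroup (X ≃ᵢ X))
    (hΓ : Nontrivial (HypIsom.LimitSet o Γ)) :
    (∀ S : Set (X ≃ᵢ X), S ⊆ (Γ : Set (X ≃ᵢ X)) → HypIsom.SeparatedIsom o S →
      HypIsom.CoveringIsom o S (Γ : Set (X ≃ᵢ X)) →
      Tendsto (fun n : ℕ => HypIsom.logRate {γ ∈ S | dist o (γ o) ≤ (n : ℝ)}.encard n)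
        atTop (𝓝 (HypIsom.entropyIsom o (Γ : Set (X ≃ᵢ X))))) ∧
    (HypIsom.SeparatedIsom o (Γ : Set (X ≃ᵢ X)) →
      Tendsto (fun n : ℕ =>
          HypIsom.logRate {γ ∈ (Γ : Set (X ≃ᵢ X)) | dist o (γ o) ≤ (n : ℝ)}.encard n)
        atTop (𝓝 (HypIsom.criticalExponentIsom o (Γ : Set (X ≃ᵢ X))))) := by
  refine ⟨fun S hSΓ hS hcov => HypIsom.tendsto_logRate hX hΓ hSΓ hS hcov, fun hsep => ?_⟩
  -- A separated Γ covers itself, so S = Γ is allowed and the entropy equals the critical exponent.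
  have hlim := HypIsom.tendsto_logRate hX hΓ Subset.rfl hsep
    ⟨1, one_pos, fun y hy => ⟨y, hy, by simp⟩⟩
  have hcrit : HypIsom.criticalExponentIsom o (Γ : Set (X ≃ᵢ X)) =
      HypIsom.entropyIsom o (Γ : Set (X ≃ᵢ X)) := by
    rw [← hlim.limsup_eq, HypIsom.criticalExponentIsom, HypIsom.criticalExponent]
    simp only [HypIsom.encard_closedBall_inter_orbit hsep]
  rw [hcrit]
  exact hlim
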